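/- Let $d \ge 1$, let $\mathbb{S}^{d-1}$ be the unit sphere of $\mathbb{R}^d$, and let $d_1 : \mathbb{R}\times\mathbb{R} \to [0,\infty)$ be a (Borel measurable) pseudo-metric, i.e. $d_1$ is symmetric and there is $C>0$ with $d_1(x,z) \le C\,[d_1(x,y)+d_1(y,z)]$ for all $x,y,z$. Let $\beta \in [0,1]$. For Borel probability measures $p,q$ on $\mathbb{R}$ put $$D_{fgw}(p,q) = \inf_{\pi \in \Pi(p,q)} \Big\{ (1-\beta)\int d_1(x,y)\, d\pi(x,y) + \beta \iint \big[d_1(x,x') - d_1(y,y')\big]^2 d\pi(x,y)\, d\pi(x',y') \Big\} \in [0,\infty],$$ where $\Pi(p,q)$ is the set of couplings of $p$ and $q$ and $0\cdot\infty=0$. For Borel probability measures $\mu,\nu$ on $\mathbb{R}^d$ and $\theta\in\mathbb{S}^{d-1}$ let $\theta\sharp\mu$ be the push-forward of $\mu$ under $x \mapsto \theta^\top x$, and write $D(\theta) = D_{fgw}(\theta\sharp\mu,\theta\sharp\nu)$. For $\epsilon\in\mathbb{S}^{d-1}$ and $\kappa\ge 0$ let $\mathrm{vMF}(\cdot|\epsilon,\kappa)$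 be the von Mises–Fisher distribution, i.e. the probability measure on $\mathbb{S}^{d-1}$ whose density with respect to surface measure is proportional to $x\mapsto\exp(\kappa\,\epsilon^\top x)$. Define, with values in $[0,\infty]$, $$\mathrm{SFG} = \mathbb{E}_{\theta\sim\mathcal{U}(\mathbb{S}^{d-1})}[D(\theta)],\qquad \text{max-SFG} = \sup_{\theta\in\mathbb{S}^{d-1}} D(\theta),\qquad \mathrm{SSFG}(\kappa) = \sup_{\epsilon\in\mathbb{S}^{d-1}} \mathbb{E}_{\theta\sim \mathrm{vMF}(\cdot|\epsilon,\kappa)}[D(\theta)],$$ and, for $k \ge 1$, concentration parameters $\kappa_1,\dots,\kappa_k\ge 0$ and mixture weights $\alpha_1,\dots,\alpha_k\ge 0$ with $\sum_i\alpha_i=1$, $$\mathrm{MSSFG}(\{\kappa_i\},\{\alpha_i\}) = \sup_{\epsilon_1,\dots,\epsilon_k\in\mathbb{S}^{d-1}} \mathbb{E}_{\theta\sim\sum_{i=1}^k\alpha_i \mathrm{vMF}(\cdot|\epsilon_i,\kappa_i)}[D(\theta)].$$ Then, for all such $\mu,\nu$, the following holds. (a) For any mixture weights $\{\alpha_i\}_{i=1}^k$,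 $$\lim_{\kappa_1,\dots,\kappa_k\to 0} \mathrm{MSSFG}(\{\kappa_i\},\{\alpha_i\}) = \mathrm{SFG},$$ and, if $d_1$ is continuous, $$\lim_{\kappa_1,\dots,\kappa_k\to\infty} \mathrm{MSSFG}(\{\kappa_i\},\{\alpha_i\}) = \text{max-SFG}.$$ (b) For any concentration parameters $\{\kappa_i\}_{i=1}^k$ and mixture weights $\{\alpha_i\}_{i=1}^k$, $$\alpha_{\bar i}\,\max_{1\le i\le k} \mathrm{SSFG}(\kappa_i) \;\le\; \mathrm{MSSFG}(\{\kappa_i\},\{\alpha_i\}) \;\le\; \max_{1\le i\le k}\mathrm{SSFG}(\kappa_i)$$ for every $\bar i \in \arg\max_{1\le i\le k}\mathrm{SSFG}(\kappa_i)$. -/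

import Mathlib

open MeasureTheory Filter Topology
open scoped ENNReal NNReal

noncomputable section

/-- Pseudo-metrics on `ℝ` in the weak sense: non-negative (built into the codomain), symmetric,
and satisfying the triangle inequality up to a universal constant `C > 0`. -/
structure IsPseudoMetric (d₁ : ℝ → ℝ → ℝ≥0) : Prop where
  symm : ∀ x y, d₁ x y = d₁ y x
  weak_triangle : ∃ C : ℝ≥0, 0 < C ∧ ∀ x y z, d₁ x z ≤ C * (d₁ x y + d₁ y z)

/-- The unit sphere `𝕊^{d-1}` of `ℝ^d`. -/
abbrev UnitSphere (d : ℕ) : Type := Metric.sphere (0 : EuclideanSpace ℝ (Fin d)) 1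

/-- The surface measure on `𝕊^{d-1}` (for `d = 1` it is the counting measure on `{-1, 1}`). -/
def surfaceMeasure (d : ℕ) : Measure (UnitSphere d) :=
  (volume : Measure (EuclideanSpace ℝ (Fin d))).toSphere

/-- The uniform distribution `𝒰(𝕊^{d-1})`. -/
def uniformSphere (d : ℕ) : Measure (UnitSphere d) :=
  (surfaceMeasure d Set.univ)⁻¹ • surfaceMeasure d

/-- The von Mises–Fisher distribution `vMF(· | ε, κ)`: the probability measure on `𝕊^{d-1}` whose
density with respect to the surface measure is `exp (κ ⟪ε, x⟫) / ∫ exp (κ ⟪ε, y⟫) dσ(y)`,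
that is, `C_d(κ) exp (κ ⟪ε, x⟫)` with `C_d(κ)` the normalization constant. -/
def vMF {d : ℕ} (ε : UnitSphere d) (κ : ℝ) : Measure (UnitSphere d) :=
  (surfaceMeasure d).tilted fun x =>
    κ * inner ℝ (ε : EuclideanSpace ℝ (Fin d)) (x : EuclideanSpace ℝ (Fin d))

/-- The mixture `∑ i, α i • vMF(· | ε i, κ i)` of von Mises–Fisher distributions. -/
def MovMF {d k : ℕ} (ε : Fin k → UnitSphere d) (κ : Fin k → ℝ) (α : Fin k → ℝ≥0) :
    Measure (UnitSphere d) :=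
  ∑ i, α i • vMF (ε i) (κ i)

/-- The push-forward `θ ♯ μ` of `μ` under the projection `x ↦ θᵀ x`. -/
def project {d : ℕ} (θ : UnitSphere d) (μ : Measure (EuclideanSpace ℝ (Fin d))) : Measure ℝ :=
  μ.map fun x => inner ℝ (θ : EuclideanSpace ℝ (Fin d)) x

/-- The set `Π(p, q)` of transport plans between `p` and `q`. -/
def transportPlans (p q : Measure ℝ) : Set (Measure (ℝ × ℝ)) :=
  {π | π.fst = p ∧ π.snd = q}

/-- The objective of the fused Gromov Wasserstein problem at the plan `π`:
`(1-β) ∫ d₁(x, y) dπ(x, y) + β ∫∫ (d₁(x, x') - d₁(y, y'))² dπ(x, y) dπ(x', y')`. -/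
def fgwCost (d₁ : ℝ → ℝ → ℝ≥0) (β : ℝ) (π : Measure (ℝ × ℝ)) : ℝ≥0∞ :=
  ENNReal.ofReal (1 - β) * ∫⁻ z, (d₁ z.1 z.2 : ℝ≥0∞) ∂π +
    ENNReal.ofReal β *
      ∫⁻ w, ENNReal.ofReal (((d₁ w.1.1 w.2.1 : ℝ) - (d₁ w.1.2 w.2.2 : ℝ)) ^ 2) ∂(π.prod π)

/-- The fused Gromov Wasserstein discrepancy `D_fgw(p, q; β, d₁)`, with values in `[0, ∞]`. -/
def Dfgw (d₁ : ℝ → ℝ → ℝ≥0) (β : ℝ) (p q : Measure ℝ) : ℝ≥0∞ :=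
  ⨅ π ∈ transportPlans p q, fgwCost d₁ β π

/-- Sliced fused Gromov Wasserstein. -/
def SFG {d : ℕ} (d₁ : ℝ → ℝ → ℝ≥0) (μ ν : Measure (EuclideanSpace ℝ (Fin d))) (β : ℝ) : ℝ≥0∞ :=
  ∫⁻ θ, Dfgw d₁ β (project θ μ) (project θ ν) ∂(uniformSphere d)

/-- Max sliced fused Gromov Wasserstein. -/
def maxSFG {d : ℕ} (d₁ : ℝ → ℝ → ℝ≥0) (μ ν : Measure (EuclideanSpace ℝ (Fin d))) (β : ℝ) :
    ℝ≥0∞ :=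
  ⨆ θ : UnitSphere d, Dfgw d₁ β (project θ μ) (project θ ν)

/-- Spherical sliced fused Gromov Wasserstein. -/
def SSFG {d : ℕ} (d₁ : ℝ → ℝ → ℝ≥0) (μ ν : Measure (EuclideanSpace ℝ (Fin d))) (β κ : ℝ) :
    ℝ≥0∞ :=
  ⨆ ε : UnitSphere d, ∫⁻ θ, Dfgw d₁ β (project θ μ) (project θ ν) ∂(vMF ε κ)

/-- Mixture spherical sliced fused Gromov Wasserstein. -/
def MSSFG {d k : ℕ} (d₁ : ℝ → ℝ → ℝ≥0) (μ ν : Measure (EuclideanSpace ℝ (Fin d))) (β : ℝ)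
    (κ : Fin k → ℝ) (α : Fin k → ℝ≥0) : ℝ≥0∞ :=
  ⨆ ε : Fin k → UnitSphere d, ∫⁻ θ, Dfgw d₁ β (project θ μ) (project θ ν) ∂(MovMF ε κ α)

end

/-! Integrating against a mixture gives the weighted sum of the integrals against its components.
Bounding each by its supremum gives the upper bound in (b); keeping one summand gives the lower one.
For small `κ`, changing `κ` to `κ'` changes a vMF integral by a factor of at most `exp (2 * |κ -
κ'|)`. Comparison with `κ' = 0`, the uniform law, squeezes MSSFG between multiples of SFG tending to
it (`lintegral_vMF_le_vMF`). For large `κ`, vMF concentrates at its location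
(`tendsto_vMF_of_isOpen`). If `D` is lower semicontinuous, it stays large near a near-maximiser,
where all locations are placed. Lower semicontinuity follows from Prokhorov's theorem applied to
near-optimal plans (`lowerSemicontinuous_Dfgw_project`). -/

open scoped BoundedContinuousFunction

/-! ### Lower semicontinuity of the transport cost -/

/-- The integral of a continuous non-negative function is lower semicontinuous in the probability
measure, for the topology of convergence in distribution. -/
theorem lowerSemicontinuous_lintegral_probabilityMeasure {X : Type*} [TopologicalSpace X]
    [MeasurableSpace X] [OpensMeasurableSpace X] {f : X → ℝ≥0} (hf : Continuous f) :
    LowerSemicontinuous fun π : ProbabilityMeasure X => ∫⁻ x, (f x : ℝ≥0∞) ∂(π : Measure X) := by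
  have key (π : ProbabilityMeasure X) : ∫⁻ x, (f x : ℝ≥0∞) ∂(π : Measure X) =
      ⨆ n : ℕ, ∫⁻ x, ((min (f x) n : ℝ≥0) : ℝ≥0∞) ∂(π : Measure X) := by
    rw [← lintegral_iSup]
    · refine lintegral_congr fun x => le_antisymm ?_ (iSup_le fun n => by simp)
      obtain ⟨n, hn⟩ := exists_nat_ge (f x)
      exact le_iSup_of_le n (by simp [hn])
    · intro n
      exact (hf.min continuous_const).measurable.coe_nnreal_ennreal
    · intro m n hmn x
      have : (m : ℝ≥0) ≤ n := by exact_mod_cast hmn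
      exact ENNReal.coe_le_coe.2 (min_le_min_left _ this)
  -- Truncated integrands are bounded, so their integrals are weakly continuous; a supremum of
  -- continuous functions is lower semicontinuous.
  simp_rw [key]
  refine lowerSemicontinuous_iSup fun n => Continuous.lowerSemicontinuous ?_
  let g : X →ᵇ ℝ≥0 := BoundedContinuousFunction.mkOfBound
    ⟨fun x => min (f x) n, hf.min continuous_const⟩ n (fun x y => by
      rw [NNReal.dist_eq, abs_le]
      have h (z : X) : ((min (f z) n : ℝ≥0) : ℝ) ≤ n := by exact_mod_cast min_le_right _ _
      have h1 := h x
      have h2 := h y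
      have h3 := (min (f x) (n : ℝ≥0)).coe_nonneg
      have h4 := (min (f y) (n : ℝ≥0)).coe_nonneg
      constructor
      · change -(n : ℝ) ≤ ((min (f x) n : ℝ≥0) : ℝ) - ((min (f y) n : ℝ≥0) : ℝ)
        linarith
      · change ((min (f x) n : ℝ≥0) : ℝ) - ((min (f y) n : ℝ≥0) : ℝ) ≤ (n : ℝ)
        linarith)
  exact ProbabilityMeasure.continuous_lintegral_boundedContinuousFunction g

theorem lowerSemicontinuous_fgwCost {d₁ : ℝ → ℝ → ℝ≥0} (hd₁ : Continuous (Function.uncurry d₁))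
    (β : ℝ) : LowerSemicontinuous fun π : ProbabilityMeasure (ℝ × ℝ) => fgwCost d₁ β π := by
  have const_mul {Y : Type} [TopologicalSpace Y] {g : Y → ℝ≥0∞} (hg : LowerSemicontinuous g)
      (c : ℝ) : LowerSemicontinuous fun y => ENNReal.ofReal c * g y :=
    (ENNReal.continuous_const_mul ENNReal.ofReal_ne_top).comp_lowerSemicontinuous hg
      fun _ _ h => mul_le_mul_right h _
  have hc {Y : Type} [TopologicalSpace Y] {f g : Y → ℝ} (hf : Continuous f) (hg : Continuous g) :
      Continuous fun y => d₁ (f y) (g y) := hd₁.comp (hf.prodMk hg)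
  refine (const_mul (lowerSemicontinuous_lintegral_probabilityMeasure
    (f := fun z : ℝ × ℝ => d₁ z.1 z.2) hd₁) (1 - β)).add (const_mul ?_ β)
  have hsq : Continuous fun w : (ℝ × ℝ) × (ℝ × ℝ) =>
      (((d₁ w.1.1 w.2.1 : ℝ) - (d₁ w.1.2 w.2.2 : ℝ)) ^ 2).toNNReal := by
    refine continuous_real_toNNReal.comp (Continuous.pow (.sub ?_ ?_) 2) <;>
    exact NNReal.continuous_coe.comp (hc (by fun_prop) (by fun_prop))
  -- The quadratic term is a linear functional of `π ⊗ π`, which depends continuously on `π`.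
  exact (lowerSemicontinuous_lintegral_probabilityMeasure hsq).comp
    (ProbabilityMeasure.continuous_prod.comp (continuous_id.prodMk continuous_id))

/-! ### Projections and lower semicontinuity of `D` -/

instance isProbabilityMeasure_project {d : ℕ} (θ : UnitSphere d)
    (μ : Measure (EuclideanSpace ℝ (Fin d))) [IsProbabilityMeasure μ] :
    IsProbabilityMeasure (project θ μ) :=
  Measure.isProbabilityMeasure_map (by fun_prop)

/-- The push-forward `θ ♯ μ` as a bundled probability measure. -/
noncomputable def projectProbabilityMeasure {d : ℕ} (θ : UnitSphere d)
    (μ : Measure (EuclideanSpace ℝ (Fin d))) [IsProbabilityMeasure μ] : ProbabilityMeasure ℝ :=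
  ⟨project θ μ, inferInstance⟩

/-- Since `|⟪θ, x⟫| ≤ ‖x‖`, one interval serves all directions. -/
theorem isTightMeasureSet_range_project {d : ℕ} (μ : Measure (EuclideanSpace ℝ (Fin d)))
    [IsProbabilityMeasure μ] :
    IsTightMeasureSet (Set.range fun θ : UnitSphere d => project θ μ) := by
  rw [isTightMeasureSet_iff_exists_isCompact_measure_compl_le]
  intro ε hε
  obtain ⟨K, hK, hμK⟩ := isTightMeasureSet_iff_exists_isCompact_measure_compl_le.1
    (isTightMeasureSet_singleton (μ := μ)) ε hε
  obtain ⟨R, hR⟩ := hK.isBounded.exists_norm_le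
  refine ⟨Metric.closedBall 0 R, isCompact_closedBall _ _, ?_⟩
  rintro _ ⟨θ, rfl⟩
  dsimp only [project]
  rw [Measure.map_apply (by fun_prop) Metric.isClosed_closedBall.measurableSet.compl]
  refine le_trans (measure_mono (Set.compl_subset_compl.2 fun x hxK => ?_ : _ ⊆ Kᶜ)) (hμK μ rfl)
  have h := norm_inner_le_norm (𝕜 := ℝ) (θ : EuclideanSpace ℝ (Fin d)) x
  rw [norm_eq_of_mem_sphere θ, one_mul] at h
  exact mem_closedBall_zero_iff.2 (h.trans (hR x hxK))

theorem continuous_projectProbabilityMeasure {d : ℕ} (μ : Measure (EuclideanSpace ℝ (Fin d)))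
    [IsProbabilityMeasure μ] :
    Continuous fun θ : UnitSphere d => projectProbabilityMeasure θ μ := by
  rw [ProbabilityMeasure.continuous_iff_forall_continuous_lintegral]
  intro f
  have h (θ : UnitSphere d) : ∫⁻ t, (f t : ℝ≥0∞) ∂(project θ μ) =
      ∫⁻ x, (f (inner ℝ (θ : EuclideanSpace ℝ (Fin d)) x) : ℝ≥0∞) ∂μ :=
    lintegral_map f.continuous.measurable.coe_nnreal_ennreal (by fun_prop)
  obtain ⟨C, hC⟩ : ∃ C : ℝ≥0, ∀ t, f t ≤ C := ⟨nndist 0 f, f.apply_le_nndist_zero⟩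
  simp only [projectProbabilityMeasure, ProbabilityMeasure.coe_mk, h]
  refine continuous_iff_continuousAt.2 fun θ₀ =>
    tendsto_lintegral_filter_of_dominated_convergence (fun _ => (C : ℝ≥0∞)) ?_ ?_ ?_ ?_
  · exact .of_forall fun θ => by
      have := f.continuous.measurable
      fun_prop
  · exact .of_forall fun θ => .of_forall fun x => ENNReal.coe_le_coe.2 (hC _)
  · simp
  · refine .of_forall fun x => ENNReal.tendsto_coe.2 (Continuous.tendsto ?_ θ₀)
    exact f.continuous.comp (by fun_prop)

theorem lowerSemicontinuous_Dfgw_project {d : ℕ} {d₁ : ℝ → ℝ → ℝ≥0}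
    (hd₁ : Continuous (Function.uncurry d₁)) (μ ν : Measure (EuclideanSpace ℝ (Fin d)))
    [IsProbabilityMeasure μ] [IsProbabilityMeasure ν] (β : ℝ) :
    LowerSemicontinuous fun θ : UnitSphere d => Dfgw d₁ β (project θ μ) (project θ ν) := by
  intro θ₀ c hc
  by_contra hcon
  -- The room between `c` and `c'` allows plans that are only near-optimal.
  obtain ⟨c', hcc', hc'⟩ := exists_between hc
  have hfreq : ∃ᶠ θ in 𝓝 θ₀, Dfgw d₁ β (project θ μ) (project θ ν) ≤ c :=
    fun h => hcon (h.mono fun θ => not_le.1)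
  have : (𝓝 θ₀ ⊓ 𝓟 {θ | Dfgw d₁ β (project θ μ) (project θ ν) ≤ c}).NeBot :=
    frequently_mem_iff_neBot.1 hfreq
  obtain ⟨U, hU⟩ := Ultrafilter.exists_le (𝓝 θ₀ ⊓ 𝓟 {θ | Dfgw d₁ β (project θ μ) (project θ ν) ≤ c})
  have hplan (θ : UnitSphere d) : ∃ π : ProbabilityMeasure (ℝ × ℝ),
      (π : Measure (ℝ × ℝ)) ∈ transportPlans (project θ μ) (project θ ν) ∧
      (Dfgw d₁ β (project θ μ) (project θ ν) ≤ c → fgwCost d₁ β π < c') := by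
    by_cases h : Dfgw d₁ β (project θ μ) (project θ ν) ≤ c
    · have h' := h.trans_lt hcc'
      simp only [Dfgw, iInf_lt_iff] at h'
      obtain ⟨π, hπ, hlt⟩ := h'
      have : IsProbabilityMeasure π := by
        constructor
        rw [← Measure.fst_univ, hπ.1, measure_univ]
      exact ⟨⟨π, this⟩, hπ, fun _ => hlt⟩
    -- A filler plan: it keeps `π` total, with the right marginals, hence tight.
    · exact ⟨⟨(project θ μ).prod (project θ ν), inferInstance⟩,
        ⟨Measure.fst_prod, Measure.snd_prod⟩, fun h' => absurd h' h⟩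
  choose π hπ hπc using hplan
  have htight : IsTightMeasureSet
      {((ρ : ProbabilityMeasure (ℝ × ℝ)) : Measure (ℝ × ℝ)) | ρ ∈ Set.range π} := by
    refine IsTightMeasureSet.prodMk ((isTightMeasureSet_range_project μ).subset ?_)
      ((isTightMeasureSet_range_project ν).subset ?_)
    · rintro _ ⟨_, ⟨_, ⟨θ, rfl⟩, rfl⟩, rfl⟩
      exact ⟨θ, (hπ θ).1.symm⟩
    · rintro _ ⟨_, ⟨_, ⟨θ, rfl⟩, rfl⟩, rfl⟩
      exact ⟨θ, (hπ θ).2.symm⟩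
  -- By Prokhorov the plans converge along the ultrafilter; the limit couples the projections along
  -- `θ₀`, so its cost exceeds `c'`, against lower semicontinuity.
  obtain ⟨π₀, -, hlim : Tendsto π U (𝓝 π₀)⟩ :=
    (isCompact_closure_of_isTightMeasureSet htight).ultrafilter_le_nhds (U.map π)
      (le_principal_iff.2 (mem_of_superset (mem_map.2 (by simp)) subset_closure))
  have hUθ : Tendsto id (U : Filter (UnitSphere d)) (𝓝 θ₀) := hU.trans inf_le_left
  have marginal {f : ℝ × ℝ → ℝ} (hf : Continuous f) {ρ : Measure (EuclideanSpace ℝ (Fin d))}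
      [IsProbabilityMeasure ρ] (h : ∀ θ, (π θ : Measure (ℝ × ℝ)).map f = project θ ρ) :
      (π₀ : Measure (ℝ × ℝ)).map f = project θ₀ ρ := by
    have h1 := ProbabilityMeasure.tendsto_map_of_tendsto_of_continuous π π₀ hlim hf
    have h2 := ((continuous_projectProbabilityMeasure ρ).tendsto θ₀).comp hUθ
    have h3 : (fun θ => (π θ).map hf.measurable.aemeasurable) =
        (fun θ : UnitSphere d => projectProbabilityMeasure θ ρ) ∘ id := by
      funext θ
      exact Subtype.ext (h θ)
    rw [h3] at h1
    exact congrArg ProbabilityMeasure.toMeasure (tendsto_nhds_unique h1 h2)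
  have hπ₀ : (π₀ : Measure (ℝ × ℝ)) ∈ transportPlans (project θ₀ μ) (project θ₀ ν) :=
    ⟨marginal continuous_fst fun θ => (hπ θ).1, marginal continuous_snd fun θ => (hπ θ).2⟩
  have hlt : c' < fgwCost d₁ β π₀ := hc'.trans_le (iInf₂_le _ hπ₀)
  have hev := hlim.eventually (lowerSemicontinuous_fgwCost hd₁ β π₀ c' hlt)
  have hle : ∀ᶠ θ in (U : Filter (UnitSphere d)), Dfgw d₁ β (project θ μ) (project θ ν) ≤ c :=
    hU.trans inf_le_right (mem_principal_self _)
  obtain ⟨θ, h1, h2⟩ := (hev.and hle).exists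
  exact (h1.trans (hπc θ h2)).false

/-! ### Comparison and concentration of vMF distributions -/

instance isFiniteMeasure_surfaceMeasure (d : ℕ) : IsFiniteMeasure (surfaceMeasure d) :=
  inferInstanceAs (IsFiniteMeasure (volume : Measure (EuclideanSpace ℝ (Fin d))).toSphere)

instance isOpenPosMeasure_surfaceMeasure (d : ℕ) : (surfaceMeasure d).IsOpenPosMeasure :=
  inferInstanceAs (volume : Measure (EuclideanSpace ℝ (Fin d))).toSphere.IsOpenPosMeasure

theorem UnitSphere.nonempty {d : ℕ} (hd : 1 ≤ d) : Nonempty (UnitSphere d) :=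
  have : Nontrivial (EuclideanSpace ℝ (Fin d)) :=
    Module.nontrivial_of_finrank_pos (R := ℝ) (by simpa using Nat.lt_of_lt_of_le one_pos hd)
  (NormedSpace.sphere_nonempty.2 zero_le_one).to_subtype

theorem integrable_exp_mul_inner {d : ℕ} (ε : UnitSphere d) (κ : ℝ) :
    Integrable (fun x : UnitSphere d => Real.exp (κ * inner ℝ (ε : EuclideanSpace ℝ (Fin d))
      (x : EuclideanSpace ℝ (Fin d)))) (surfaceMeasure d) :=
  Continuous.integrable_of_hasCompactSupport (by fun_prop) (HasCompactSupport.of_compactSpace _)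

instance isProbabilityMeasure_vMF {d : ℕ} (ε : UnitSphere d) (κ : ℝ) :
    IsProbabilityMeasure (vMF ε κ) :=
  have : Nonempty (UnitSphere d) := ⟨ε⟩
  isProbabilityMeasure_tilted (integrable_exp_mul_inner ε κ)

theorem vMF_zero {d : ℕ} (ε : UnitSphere d) : vMF ε 0 = uniformSphere d := by
  rw [uniformSphere, ← tilted_zero', vMF]
  simp only [zero_mul]
  rfl

/-- Exponential tiltings by uniformly close functions are comparable. -/
theorem lintegral_tilted_le_of_abs_sub_le {X : Type*} [MeasurableSpace X] {σ : Measure X}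
    [NeZero σ] {f g : X → ℝ} (hf : Integrable (fun x => Real.exp (f x)) σ)
    (hg : Integrable (fun x => Real.exp (g x)) σ) {c : ℝ} (hfg : ∀ x, |f x - g x| ≤ c)
    (h : X → ℝ≥0∞) :
    ∫⁻ x, h x ∂(σ.tilted f) ≤ ENNReal.ofReal (Real.exp (2 * c)) * ∫⁻ x, h x ∂(σ.tilted g) := by
  rw [lintegral_tilted, lintegral_tilted, ← lintegral_const_mul' _ _ ENNReal.ofReal_ne_top]
  refine lintegral_mono fun x => ?_
  rw [← mul_assoc, ← ENNReal.ofReal_mul (Real.exp_pos _).le]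
  refine mul_le_mul_left (ENNReal.ofReal_le_ofReal ?_) _
  have hZf := integral_exp_pos hf
  have hZg := integral_exp_pos hg
  -- One factor `exp c` comes from the density, another from the normalising constant.
  have h1 : Real.exp (f x) ≤ Real.exp c * Real.exp (g x) := by
    rw [← Real.exp_add]
    exact Real.exp_le_exp.2 (by linarith [(abs_le.1 (hfg x)).2])
  have h2 : ∫ y, Real.exp (g y) ∂σ ≤ Real.exp c * ∫ y, Real.exp (f y) ∂σ := by
    rw [← integral_const_mul]
    refine integral_mono hg (hf.const_mul _) fun y => ?_
    change Real.exp (g y) ≤ Real.exp c * Real.exp (f y)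
    rw [← Real.exp_add]
    exact Real.exp_le_exp.2 (by linarith [(abs_le.1 (hfg y)).1])
  rw [two_mul, Real.exp_add, ← mul_div_assoc, div_le_div_iff₀ hZf hZg]
  calc Real.exp (f x) * ∫ y, Real.exp (g y) ∂σ
      ≤ (Real.exp c * Real.exp (g x)) * (Real.exp c * ∫ y, Real.exp (f y) ∂σ) :=
        mul_le_mul h1 h2 hZg.le (by positivity)
    _ = _ := by ring

theorem abs_inner_unitSphere_le_one {d : ℕ} (x y : UnitSphere d) :
    |inner ℝ (x : EuclideanSpace ℝ (Fin d)) (y : EuclideanSpace ℝ (Fin d))| ≤ 1 := by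
  simpa using abs_real_inner_le_norm (x : EuclideanSpace ℝ (Fin d)) y

theorem lintegral_vMF_le_vMF {d : ℕ} (ε : UnitSphere d) (κ κ' : ℝ) (h : UnitSphere d → ℝ≥0∞) :
    ∫⁻ θ, h θ ∂(vMF ε κ) ≤
      ENNReal.ofReal (Real.exp (2 * |κ - κ'|)) * ∫⁻ θ, h θ ∂(vMF ε κ') := by
  have : Nonempty (UnitSphere d) := ⟨ε⟩
  refine lintegral_tilted_le_of_abs_sub_le (integrable_exp_mul_inner ε κ)
    (integrable_exp_mul_inner ε κ') (fun x => ?_) h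
  rw [← sub_mul, abs_mul]
  exact mul_le_of_le_one_right (abs_nonneg _) (abs_inner_unitSphere_le_one ε x)

theorem dist_sq_unitSphere {d : ℕ} (x y : UnitSphere d) :
    dist x y ^ 2 =
      2 - 2 * inner ℝ (x : EuclideanSpace ℝ (Fin d)) (y : EuclideanSpace ℝ (Fin d)) := by
  rw [Subtype.dist_eq, dist_eq_norm, norm_sub_sq_real, norm_eq_of_mem_sphere,
    norm_eq_of_mem_sphere]
  ring

/-- The von Mises–Fisher distributions concentrate at their location parameter as the
concentration parameter grows. -/
theorem tendsto_vMF_of_isOpen {d : ℕ} (ε : UnitSphere d) {U : Set (UnitSphere d)}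
    (hU : IsOpen U) (hε : ε ∈ U) : Tendsto (fun κ => vMF ε κ U) atTop (𝓝 1) := by
  set σ := surfaceMeasure d
  set s : UnitSphere d → ℝ := fun x =>
    inner ℝ (ε : EuclideanSpace ℝ (Fin d)) (x : EuclideanSpace ℝ (Fin d)) with hs
  have hsc : Continuous s := by fun_prop
  obtain ⟨r, hr, hball⟩ := Metric.isOpen_iff.1 hU ε hε
  have hout (x) (hx : x ∈ Uᶜ) : s x ≤ 1 - r ^ 2 / 2 := by
    have h1 : r ≤ dist ε x := by
      by_contra h
      exact hx (hball (by simpa [dist_comm] using h))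
    have h2 := dist_sq_unitSphere ε x
    have h3 : r ^ 2 ≤ dist ε x ^ 2 := by gcongr
    simp only [hs]
    linarith
  -- A smaller cap: its threshold exceeds the bound on `s` outside `U` by `r ^ 2 / 4`, which is the
  -- rate of exponential decay.
  set V : Set (UnitSphere d) := {x | 1 - r ^ 2 / 4 < s x} with hV
  have hVo : IsOpen V := isOpen_lt continuous_const hsc
  have hVε : ε ∈ V := by
    have : s ε = 1 := by simp [hs]
    simp only [hV, Set.mem_ofPred_eq, this]
    have : 0 < r ^ 2 := by positivity
    linarith
  have hσV : 0 < σ.real V :=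
    ENNReal.toReal_pos (hVo.measure_ne_zero σ ⟨ε, hVε⟩) (measure_ne_top _ _)
  have hbound (κ : ℝ) (hκ : 0 ≤ κ) : vMF ε κ Uᶜ ≤
      ENNReal.ofReal (Real.exp (-(r ^ 2 / 4 * κ)) * (σ.real Uᶜ / σ.real V)) := by
    have hint := integrable_exp_mul_inner ε κ
    rw [vMF, tilted_apply_eq_ofReal_integral' _ hU.measurableSet.compl]
    refine ENNReal.ofReal_le_ofReal ?_
    rw [integral_div]
    have hZ : Real.exp (κ * (1 - r ^ 2 / 4)) * σ.real V ≤ ∫ x, Real.exp (κ * s x) ∂σ := by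
      refine le_trans ?_ (setIntegral_le_integral (s := V) hint
        (.of_forall fun x => (Real.exp_pos _).le))
      rw [mul_comm, ← smul_eq_mul, ← setIntegral_const]
      refine setIntegral_mono_on (integrable_const _) hint.integrableOn hVo.measurableSet
        fun x hx => Real.exp_le_exp.2 (mul_le_mul_of_nonneg_left (le_of_lt hx) hκ)
    have hN : ∫ x in Uᶜ, Real.exp (κ * s x) ∂σ ≤
        Real.exp (κ * (1 - r ^ 2 / 2)) * σ.real Uᶜ := by
      rw [mul_comm, ← smul_eq_mul, ← setIntegral_const]
      exact setIntegral_mono_on hint.integrableOn (integrable_const _) hU.measurableSet.compl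
        fun x hx => Real.exp_le_exp.2 (mul_le_mul_of_nonneg_left (hout x hx) hκ)
    calc (∫ x in Uᶜ, Real.exp (κ * s x) ∂σ) / ∫ x, Real.exp (κ * s x) ∂σ
        ≤ (Real.exp (κ * (1 - r ^ 2 / 2)) * σ.real Uᶜ) /
          (Real.exp (κ * (1 - r ^ 2 / 4)) * σ.real V) :=
          div_le_div₀ (by positivity) hN (by positivity) hZ
      _ = _ := by
        rw [mul_div_mul_comm, ← Real.exp_sub]
        congr 2
        ring
  have hlim : Tendsto (fun κ : ℝ =>
      ENNReal.ofReal (Real.exp (-(r ^ 2 / 4 * κ)) * (σ.real Uᶜ / σ.real V))) atTop (𝓝 0) := by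
    have h1 : Tendsto (fun κ : ℝ => r ^ 2 / 4 * κ) atTop atTop :=
      tendsto_id.const_mul_atTop (by positivity)
    have h2 := ((Real.tendsto_exp_neg_atTop_nhds_zero.comp h1).mul_const
      (σ.real Uᶜ / σ.real V))
    simpa using ENNReal.tendsto_ofReal h2
  have hcompl : Tendsto (fun κ => vMF ε κ Uᶜ) atTop (𝓝 0) :=
    tendsto_of_tendsto_of_tendsto_of_le_of_le' tendsto_const_nhds hlim (by simp)
      ((eventually_ge_atTop 0).mono hbound)
  have heq : (fun κ => vMF ε κ U) = fun κ => 1 - vMF ε κ Uᶜ := by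
    funext κ
    rw [← prob_compl_eq_one_sub hU.measurableSet.compl, compl_compl]
  rw [heq]
  simpa using ENNReal.Tendsto.sub tendsto_const_nhds hcompl (Or.inl ENNReal.one_ne_top)

/-! ### Bounds and limits for mixtures -/

theorem lintegral_MovMF {d k : ℕ} (ε : Fin k → UnitSphere d) (κ : Fin k → ℝ) (α : Fin k → ℝ≥0)
    (h : UnitSphere d → ℝ≥0∞) :
    ∫⁻ θ, h θ ∂(MovMF ε κ α) = ∑ i, (α i : ℝ≥0∞) * ∫⁻ θ, h θ ∂(vMF (ε i) (κ i)) := by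
  rw [MovMF, lintegral_finsetSum_measure]
  refine Finset.sum_congr rfl fun i _ => ?_
  rw [lintegral_smul_measure, ENNReal.smul_def, smul_eq_mul]

section MSSFG

variable {d k : ℕ} {d₁ : ℝ → ℝ → ℝ≥0} {μ ν : Measure (EuclideanSpace ℝ (Fin d))} {β : ℝ}
  {α : Fin k → ℝ≥0}

theorem sum_mul_lintegral_vMF_le_MSSFG (ε : Fin k → UnitSphere d) (κ : Fin k → ℝ) :
    ∑ i, (α i : ℝ≥0∞) * ∫⁻ θ, Dfgw d₁ β (project θ μ) (project θ ν) ∂(vMF (ε i) (κ i)) ≤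
      MSSFG d₁ μ ν β κ α := by
  rw [← lintegral_MovMF]
  exact le_iSup (fun ε => ∫⁻ θ, Dfgw d₁ β (project θ μ) (project θ ν) ∂(MovMF ε κ α)) ε

theorem MSSFG_le_sum_mul_SSFG (κ : Fin k → ℝ) :
    MSSFG d₁ μ ν β κ α ≤ ∑ i, (α i : ℝ≥0∞) * SSFG d₁ μ ν β (κ i) := by
  refine iSup_le fun ε => ?_
  rw [lintegral_MovMF]
  gcongr with i
  exact le_iSup (fun ε => ∫⁻ θ, Dfgw d₁ β (project θ μ) (project θ ν) ∂(vMF ε (κ i))) (ε i)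

theorem sum_mul_le_of_sum_eq_one (hα : ∑ i, α i = 1) {a : Fin k → ℝ≥0∞} {b : ℝ≥0∞}
    (h : ∀ i, a i ≤ b) : ∑ i, (α i : ℝ≥0∞) * a i ≤ b := by
  calc ∑ i, (α i : ℝ≥0∞) * a i ≤ ∑ i, (α i : ℝ≥0∞) * b := by gcongr with i; exact h i
    _ = b := by
      rw [← Finset.sum_mul, ← ENNReal.ofNNReal_finsetSum, hα, ENNReal.coe_one, one_mul]

theorem SSFG_le_maxSFG (κ : ℝ) : SSFG d₁ μ ν β κ ≤ maxSFG d₁ μ ν β :=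
  iSup_le fun _ => lintegral_le_iSup _

theorem MSSFG_le_maxSFG (hα : ∑ i, α i = 1) (κ : Fin k → ℝ) :
    MSSFG d₁ μ ν β κ α ≤ maxSFG d₁ μ ν β :=
  (MSSFG_le_sum_mul_SSFG κ).trans (sum_mul_le_of_sum_eq_one hα fun i => SSFG_le_maxSFG (κ i))

theorem mul_SSFG_le_MSSFG (κ : Fin k → ℝ) (j : Fin k) :
    (α j : ℝ≥0∞) * SSFG d₁ μ ν β (κ j) ≤ MSSFG d₁ μ ν β κ α := by
  rw [SSFG, ENNReal.mul_iSup]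
  -- All locations are set to `ε`, and every summand but `j` is dropped.
  refine iSup_le fun ε => le_trans ?_ (sum_mul_lintegral_vMF_le_MSSFG (fun _ => ε) κ)
  exact Finset.single_le_sum (f := fun i => (α i : ℝ≥0∞) *
    ∫⁻ θ, Dfgw d₁ β (project θ μ) (project θ ν) ∂(vMF ε (κ i))) (by simp) (Finset.mem_univ j)

theorem SSFG_le_exp_mul_SFG (κ : ℝ) :
    SSFG d₁ μ ν β κ ≤ ENNReal.ofReal (Real.exp (2 * |κ|)) * SFG d₁ μ ν β := by
  refine iSup_le fun ε => ?_
  simpa [vMF_zero] using! lintegral_vMF_le_vMF ε κ 0 _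

theorem exp_neg_mul_SFG_le_lintegral_vMF (ε : UnitSphere d) (κ : ℝ) :
    ENNReal.ofReal (Real.exp (-(2 * |κ|))) * SFG d₁ μ ν β ≤
      ∫⁻ θ, Dfgw d₁ β (project θ μ) (project θ ν) ∂(vMF ε κ) := by
  have h := lintegral_vMF_le_vMF ε 0 κ fun θ => Dfgw d₁ β (project θ μ) (project θ ν)
  rw [vMF_zero, zero_sub, abs_neg] at h
  refine (mul_le_mul_right h _).trans_eq ?_
  rw [← mul_assoc, ← ENNReal.ofReal_mul (Real.exp_pos _).le, ← Real.exp_add]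
  simp

theorem tendsto_MSSFG_zero (hd : 1 ≤ d) (hα : ∑ i, α i = 1) :
    Tendsto (fun κ : Fin k → ℝ => MSSFG d₁ μ ν β κ α) (𝓝 0) (𝓝 (SFG d₁ μ ν β)) := by
  obtain ⟨ε⟩ := UnitSphere.nonempty hd
  have key {f : ℝ → ℝ} (hf : Continuous f) (hf0 : f 0 = 1) :
      Tendsto (fun κ : Fin k → ℝ =>
        ∑ i, (α i : ℝ≥0∞) * (ENNReal.ofReal (f (κ i)) * SFG d₁ μ ν β)) (𝓝 0)
        (𝓝 (SFG d₁ μ ν β)) := by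
    have h1 : Tendsto (fun κ : Fin k → ℝ => ∑ i, (α i : ℝ≥0∞) * ENNReal.ofReal (f (κ i))) (𝓝 0)
        (𝓝 1) := by
      have h2 : ∑ i, (α i : ℝ≥0∞) * 1 = 1 := by
        simp only [mul_one]
        rw [← ENNReal.ofNNReal_finsetSum, hα, ENNReal.coe_one]
      rw [← h2]
      refine tendsto_finsetSum _ fun i _ =>
        ENNReal.Tendsto.const_mul ?_ (Or.inr ENNReal.coe_ne_top)
      have h3 : Continuous fun κ : Fin k → ℝ => ENNReal.ofReal (f (κ i)) :=
        ENNReal.continuous_ofReal.comp (hf.comp (continuous_apply i))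
      simpa [hf0] using h3.tendsto 0
    -- The coefficient tends to `1 ≠ 0`, so the product converges even when SFG is infinite.
    simpa [← mul_assoc, ← Finset.sum_mul] using
      ENNReal.Tendsto.mul_const (b := SFG d₁ μ ν β) h1 (Or.inl one_ne_zero)
  refine tendsto_of_tendsto_of_tendsto_of_le_of_le
    (key (f := fun t => Real.exp (-(2 * |t|))) (by fun_prop) (by simp))
    (key (f := fun t => Real.exp (2 * |t|)) (by fun_prop) (by simp)) (fun κ => ?_) fun κ => ?_
  · refine le_trans ?_ (sum_mul_lintegral_vMF_le_MSSFG (fun _ => ε) κ)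
    gcongr with i
    exact exp_neg_mul_SFG_le_lintegral_vMF ε (κ i)
  · refine (MSSFG_le_sum_mul_SSFG κ).trans ?_
    gcongr with i
    exact SSFG_le_exp_mul_SFG (κ i)

theorem tendsto_MSSFG_atTop (hα : ∑ i, α i = 1)
    (hD : LowerSemicontinuous fun θ : UnitSphere d => Dfgw d₁ β (project θ μ) (project θ ν)) :
    Tendsto (fun κ : Fin k → ℝ => MSSFG d₁ μ ν β κ α) (Filter.pi fun _ => atTop)
      (𝓝 (maxSFG d₁ μ ν β)) := by
  refine tendsto_order.2 ⟨fun c hc => ?_, fun c hc => .of_forall fun κ =>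
    (MSSFG_le_maxSFG hα κ).trans_lt hc⟩
  obtain ⟨ε, hε⟩ := lt_iSup_iff.1 hc
  obtain ⟨c', hcc', hc'⟩ := exists_between hε
  have hU : IsOpen {θ : UnitSphere d | c' < Dfgw d₁ β (project θ μ) (project θ ν)} :=
    hD.isOpen_preimage c'
  set U := {θ : UnitSphere d | c' < Dfgw d₁ β (project θ μ) (project θ ν)}
  -- With every component at `ε`, each integral is at least `c'` times the mass of `U`, and that
  -- mass tends to `1`.
  have hlim : Tendsto (fun κ : Fin k → ℝ => ∑ i, (α i : ℝ≥0∞) * (c' * vMF ε (κ i) U))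
      (Filter.pi fun _ => atTop) (𝓝 (∑ i, (α i : ℝ≥0∞) * (c' * 1))) :=
    tendsto_finsetSum _ fun i _ => ENNReal.Tendsto.const_mul
      (ENNReal.Tendsto.const_mul ((tendsto_vMF_of_isOpen ε hU hc').comp (tendsto_eval_pi _ i))
        (Or.inl one_ne_zero)) (Or.inr ENNReal.coe_ne_top)
  rw [← Finset.sum_mul, ← ENNReal.ofNNReal_finsetSum, hα, ENNReal.coe_one, one_mul, mul_one] at hlim
  filter_upwards [hlim.eventually (lt_mem_nhds hcc')] with κ hκ
  refine hκ.trans_le (le_trans ?_ (sum_mul_lintegral_vMF_le_MSSFG (fun _ => ε) κ))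
  gcongr with i
  rw [← setLIntegral_const]
  exact (setLIntegral_mono' hU.measurableSet fun θ hθ => le_of_lt hθ).trans
    (setLIntegral_le_lintegral _ _)

end MSSFG

theorem theorem5 {d k : ℕ} (hd : 1 ≤ d) (d₁ : ℝ → ℝ → ℝ≥0) (hd₁ : IsPseudoMetric d₁)
    (hd₁_meas : Measurable (Function.uncurry d₁))
    (μ ν : Measure (EuclideanSpace ℝ (Fin d))) [IsProbabilityMeasure μ] [IsProbabilityMeasure ν]
    (β : ℝ) (hβ : β ∈ Set.Icc (0 : ℝ) 1)
    (α : Fin k → ℝ≥0) (hα : ∑ i, α i = 1) :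
    -- (a), all concentration parameters tend to zero
    Tendsto (fun κ : Fin k → ℝ => MSSFG d₁ μ ν β κ α) (𝓝[{κ | ∀ i, 0 ≤ κ i}] 0)
      (𝓝 (SFG d₁ μ ν β)) ∧
    -- (a), all concentration parameters tend to infinity
    (Continuous (Function.uncurry d₁) →
      Tendsto (fun κ : Fin k → ℝ => MSSFG d₁ μ ν β κ α) (Filter.pi fun _ => atTop)
        (𝓝 (maxSFG d₁ μ ν β))) ∧
    -- (b)
    (∀ κ : Fin k → ℝ, (∀ i, 0 ≤ κ i) →
      (∀ j : Fin k, (∀ i, SSFG d₁ μ ν β (κ i) ≤ SSFG d₁ μ ν β (κ j)) →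
        (α j : ℝ≥0∞) * (⨆ i, SSFG d₁ μ ν β (κ i)) ≤ MSSFG d₁ μ ν β κ α) ∧
      MSSFG d₁ μ ν β κ α ≤ ⨆ i, SSFG d₁ μ ν β (κ i)) := by
  refine ⟨(tendsto_MSSFG_zero hd hα).mono_left nhdsWithin_le_nhds,
    fun hc => tendsto_MSSFG_atTop hα (lowerSemicontinuous_Dfgw_project hc μ ν β),
    fun κ _ => ⟨fun j hj => ?_, ?_⟩⟩
  · refine le_trans ?_ (mul_SSFG_le_MSSFG κ j)
    gcongr
    exact iSup_le hj
  · exact (MSSFG_le_sum_mul_SSFG κ).trans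
      (sum_mul_le_of_sum_eq_one hα (le_iSup fun i => SSFG d₁ μ ν β (κ i)))
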